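/- Let $\mathcal H_A,\mathcal H_{A'}$ be finite-dimensional complex Hilbert spaces (identified with $\mathbb C^n$, $\mathbb C^m$) and let $\mathcal E:\mathcal B(\mathcal H_A)\to\mathcal B(\mathcal H_{A'})$ be a channel, i.e. a completely positive trace-preserving linear map. For a linear map $\mathcal F$ between operator algebras let $\mathcal F^\dagger$ be its adjoint for the Hilbert–Schmidt inner product $\langle X,Y\rangle=\mathrm{Tr}(X^\dagger Y)$, and for a linear self-map $\mathcal Z$ of $\mathcal B(\mathcal H_A)$ let $S_{\mathcal Z}=\{X:\mathcal Z(X)=X\}$. Let $\tau=I/\dim\mathcal H_A$ be the maximally mixed state and let $$\mathcal P_{\tau,\mathcal E}[Y]=\tau^{1/2}\,\mathcal E^\dagger\!\left[\mathcal E(\tau)^{-1/2}\,Y\,\mathcal E(\tau)^{-1/2}\right]\tau^{1/2}$$ be the Petz recovery map, where $\mathcal E(\tau)^{-1/2}$ is taken on the support of $\mathcal E(\tau)$ (and is $0$ on its kernel). Let $$\mathcal A(\mathcal E)=\mathrm{Alg}\{O\in\mathcal B(\mathcal H_A): [O,E_a^\dagger E_b]=0\ \ \forall a,b\}$$ be the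 correctable algebra, where $\mathcal E(X)=\sum_a E_aXE_a^\dagger$ is a finite Kraus decomposition. Then such a decomposition exists, $\mathcal A(\mathcal E)$ does not depend on its choice, the map $\mathcal P_{\tau,\mathcal E}\circ\mathcal E$ is self-adjoint with respect to the Hilbert–Schmidt inner product, $\mathcal E^\dagger\circ\mathcal P_{\tau,\mathcal E}^\dagger=(\mathcal P_{\tau,\mathcal E}\circ\mathcal E)^\dagger$, and $$S_{\mathcal E^\dagger\circ\mathcal P_{\tau,\mathcal E}^\dagger}=S_{\mathcal P_{\tau,\mathcal E}\circ\mathcal E}=\mathcal A(\mathcal E).$$ -/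

import Mathlib

open scoped Matrix MatrixOrder Matrix.Norms.L2Operator CStarAlgebra

noncomputable section

/-- The adjoint `E†` of a linear map between matrix algebras with respect to the Hilbert-Schmidt
inner product `⟨X, Y⟩ = Tr (Xᴴ Y)`, given by its matrix entries `⟨single i j 1, E† Y⟩`.
The defining property is `trace_conjTranspose_mul_hsAdjoint` below. -/
def hsAdjoint {n m : Type*} [DecidableEq n] [Fintype m]
    (E : Matrix n n ℂ →ₗ[ℂ] Matrix m m ℂ) : Matrix m m ℂ →ₗ[ℂ] Matrix n n ℂ where
  toFun Y := Matrix.of fun i j => ((E (Matrix.single i j 1))ᴴ * Y).trace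
  map_add' Y Z := by
    ext i j
    simp [Matrix.mul_add]
  map_smul' c Y := by
    ext i j
    simp

theorem trace_conjTranspose_mul_hsAdjoint {n m : Type*} [Fintype n] [DecidableEq n] [Fintype m]
    (E : Matrix n n ℂ →ₗ[ℂ] Matrix m m ℂ) (X : Matrix n n ℂ) (Y : Matrix m m ℂ) :
    (Xᴴ * hsAdjoint E Y).trace = ((E X)ᴴ * Y).trace := by
  have hX : E X = ∑ i, ∑ j, X i j • E (Matrix.single i j 1) := by
    conv_lhs => rw [Matrix.matrix_eq_sum_single X]
    simp only [map_sum]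
    refine Finset.sum_congr rfl fun i _ => Finset.sum_congr rfl fun j _ => ?_
    rw [← map_smul, Matrix.smul_single, smul_eq_mul, mul_one]
  rw [hX]
  simp only [Matrix.conjTranspose_sum, Matrix.conjTranspose_smul, Matrix.sum_mul,
    Matrix.trace_sum, Matrix.smul_mul, Matrix.trace_smul]
  rw [Finset.sum_comm]
  simp [Matrix.trace, Matrix.mul_apply, hsAdjoint]

/-- The power `A ^ t` of a positive semidefinite matrix by functional calculus. As
`(0 : ℝ) ^ t = 0` for `t ≠ 0`, a negative power is the one taken on the support of `A`
(and zero on its kernel). -/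
def psdPow {m : Type*} [Fintype m] [DecidableEq m] (A : Matrix m m ℂ) (t : ℝ) : Matrix m m ℂ :=
  cfc (fun x : ℝ => x ^ t) A

/-- The two-sided multiplication `X ↦ A * X * A`. -/
def sandwich {m : Type*} [Fintype m] (A : Matrix m m ℂ) : Matrix m m ℂ →ₗ[ℂ] Matrix m m ℂ where
  toFun X := A * X * A
  map_add' X Y := by rw [Matrix.mul_add, Matrix.add_mul]
  map_smul' c X := by simp

/-- The Petz recovery map of `E` with reference state `σ`:
`Y ↦ σ^{1/2} E†[E(σ)^{-1/2} Y E(σ)^{-1/2}] σ^{1/2}`. -/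
def petzMap {n m : Type*} [Fintype n] [DecidableEq n] [Fintype m] [DecidableEq m]
    (σ : Matrix n n ℂ) (E : Matrix n n ℂ →ₗ[ℂ] Matrix m m ℂ) :
    Matrix m m ℂ →ₗ[ℂ] Matrix n n ℂ :=
  sandwich (psdPow σ (1 / 2)) ∘ₗ hsAdjoint E ∘ₗ sandwich (psdPow (E σ) (-(1 / 2)))

/-- The maximally mixed state `I / d`. -/
def maximallyMixed (n : Type*) [Fintype n] [DecidableEq n] : Matrix n n ℂ :=
  (Fintype.card n : ℂ)⁻¹ • (1 : Matrix n n ℂ)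

/-- `K` is a finite family of Kraus operators of `E`. -/
def IsKrausFamily {n m κ : Type*} [Fintype n] [Fintype m] [Fintype κ]
    (E : Matrix n n ℂ →ₗ[ℂ] Matrix m m ℂ) (K : κ → Matrix m n ℂ) : Prop :=
  ∀ X, E X = ∑ a, K a * X * (K a)ᴴ

/-- The algebra `Alg {O | [O, K a† K b] = 0 for all a, b}` of a family of Kraus operators. -/
def krausCorrectableAlgebra {n m κ : Type*} [Fintype n] [DecidableEq n] [Fintype m]
    (K : κ → Matrix m n ℂ) : Subalgebra ℂ (Matrix n n ℂ) :=
  Algebra.adjoin ℂ {O | ∀ a b, Commute O ((K a)ᴴ * K b)}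

/-- The correctable algebra of a completely positive map: the algebra generated by all `O` that
commute with `K a† K b` for Kraus operators `K` of the map (whichever decomposition is used). -/
def correctableAlgebra {n m : Type*} [Fintype n] [DecidableEq n] [Fintype m]
    (E : Matrix n n ℂ →ₗ[ℂ] Matrix m m ℂ) : Subalgebra ℂ (Matrix n n ℂ) :=
  Algebra.adjoin ℂ {O | ∀ (r : ℕ) (K : Fin r → Matrix m n ℂ), IsKrausFamily E K →
    ∀ a b, Commute O ((K a)ᴴ * K b)}

end

open scoped ComplexOrder

/-! Write `S` for `E(τ)^{-1/2}` and `d` for the dimension. `P ∘ E` has Kraus operators `M_ab =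
d^{-1/2} K_a† S K_b` (`petzKraus`), a family that the adjoint permutes by swapping `a` and `b`;
hence `P ∘ E` is self-adjoint. Trace preservation makes it unital, so its fixed points are the
commutant of the `M_ab` (`sum_mul_mul_conjTranspose_eq_self_iff`). This is also the commutant of the
`K_a† K_b`. On one side `∑_c M_ac M_cb = K_a† S E(τ) S K_b = K_a† K_b`, since `S E(τ) S` is a
support projection fixing `K_b`. On the other, `S` is a polynomial in `E(τ) = d^{-1} ∑ K_c K_c†`, so
`K_a† S K_b` is a polynomial in the products `K_c† K_e`. A commutant is already an algebra, and `P ∘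
E` does not mention `K`, whence independence of the decomposition. -/

theorem eq_hsAdjoint_of_trace {n m : Type*} [Fintype n] [DecidableEq n] [Fintype m]
    {E : Matrix n n ℂ →ₗ[ℂ] Matrix m m ℂ} {G : Matrix m m ℂ →ₗ[ℂ] Matrix n n ℂ}
    (h : ∀ X Y, (Xᴴ * G Y).trace = ((E X)ᴴ * Y).trace) : hsAdjoint E = G := by
  ext1 Y
  ext i j
  change ((E (Matrix.single i j 1))ᴴ * Y).trace = G Y i j
  rw [← h, Matrix.conjTranspose_single, star_one, Matrix.trace_single_mul, one_smul]

theorem hsAdjoint_comp {n m l : Type*} [Fintype n] [DecidableEq n] [Fintype m] [DecidableEq m]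
    [Fintype l] (F : Matrix m m ℂ →ₗ[ℂ] Matrix l l ℂ) (E : Matrix n n ℂ →ₗ[ℂ] Matrix m m ℂ) :
    hsAdjoint (F ∘ₗ E) = hsAdjoint E ∘ₗ hsAdjoint F :=
  eq_hsAdjoint_of_trace fun X Y => by
    simp only [LinearMap.comp_apply, trace_conjTranspose_mul_hsAdjoint]

namespace IsKrausFamily

variable {n m κ : Type*} [Fintype n] [Fintype m] [Fintype κ]
  {E : Matrix n n ℂ →ₗ[ℂ] Matrix m m ℂ} {K : κ → Matrix m n ℂ}

theorem hsAdjoint_apply [DecidableEq n] (hK : IsKrausFamily E K) (Y : Matrix m m ℂ) :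
    hsAdjoint E Y = ∑ a, (K a)ᴴ * Y * K a := by
  let G : Matrix m m ℂ →ₗ[ℂ] Matrix n n ℂ :=
    { toFun := fun Y => ∑ a, (K a)ᴴ * Y * K a
      map_add' := fun Y Z => by simp [Matrix.mul_add, Matrix.add_mul, Finset.sum_add_distrib]
      map_smul' := fun c Y => by simp [Finset.smul_sum] }
  have h : hsAdjoint E = G := eq_hsAdjoint_of_trace fun X Y => by
    rw [hK X]
    simp only [G, LinearMap.coe_mk, AddHom.coe_mk, Matrix.mul_sum, Matrix.conjTranspose_sum,
      Matrix.sum_mul, Matrix.trace_sum, Matrix.conjTranspose_mul,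
      Matrix.conjTranspose_conjTranspose]
    refine Finset.sum_congr rfl fun a _ => ?_
    rw [← Matrix.mul_assoc, Matrix.trace_mul_comm]
    simp only [Matrix.mul_assoc]
  rw [h]
  rfl

/-- The Kraus operators of a trace-preserving map satisfy `∑ K a† K a = 1`. -/
theorem sum_conjTranspose_mul_self [DecidableEq n] (hK : IsKrausFamily E K)
    (hE : ∀ X, (E X).trace = X.trace) : ∑ a, (K a)ᴴ * K a = 1 := by
  refine Matrix.ext_iff_trace_mul_right.2 fun X => ?_
  rw [Matrix.one_mul, ← hE X, hK X, Matrix.sum_mul, Matrix.trace_sum, Matrix.trace_sum]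
  refine Finset.sum_congr rfl fun a _ => ?_
  rw [Matrix.mul_assoc, Matrix.trace_mul_comm]

theorem apply_maximallyMixed [DecidableEq n] (hK : IsKrausFamily E K) :
    E (maximallyMixed n) = (((Fintype.card n : ℝ)⁻¹ : ℝ) : ℂ) • ∑ a, K a * (K a)ᴴ := by
  rw [hK]
  simp [maximallyMixed, Finset.smul_sum]

theorem reindex {ι : Type*} [Fintype ι] (hK : IsKrausFamily E K) (e : ι ≃ κ) :
    IsKrausFamily E (K ∘ e) := fun X => by
  rw [hK X]
  exact (e.sum_comp fun a => K a * X * (K a)ᴴ).symm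

end IsKrausFamily

/-! ### Existence of Kraus decompositions -/

theorem exists_eq_star_mul_self_of_nonneg {A : Type*} [NonUnitalCStarAlgebra A] [PartialOrder A]
    [StarOrderedRing A] {a : A} (ha : 0 ≤ a) : ∃ b, a = star b * b :=
  CStarAlgebra.nonneg_iff_eq_star_mul_self.1 ha

/-- A completely positive map between matrix algebras has a finite Kraus decomposition. -/
theorem exists_isKrausFamily {n m : Type*} [Fintype n] [DecidableEq n] [Fintype m] [DecidableEq m]
    (E : Matrix n n ℂ →CP Matrix m m ℂ) :
    ∃ (r : ℕ) (K : Fin r → Matrix m n ℂ), IsKrausFamily E.toLinearMap K := by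
  suffices h : ∃ K : n × m → Matrix m n ℂ, IsKrausFamily E.toLinearMap K by
    obtain ⟨K, hK⟩ := h
    exact ⟨_, _, hK.reindex (Fintype.equivFin (n × m)).symm⟩
  rcases isEmpty_or_nonempty n with hn | ⟨⟨a⟩⟩
  · refine ⟨fun _ => 0, fun X => ?_⟩
    rw [Subsingleton.elim X 0]
    simp
  -- The Choi argument: the block matrix of matrix units is `star R * R` with `R` supported on the
  -- single row `a`, so its image under `E` is again positive and factors as `star N * N`.
  let C : CStarMatrix n n (Matrix n n ℂ) := CStarMatrix.ofMatrix fun i j => Matrix.single i j 1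
  have hC : 0 ≤ C := by
    let R : CStarMatrix n n (Matrix n n ℂ) :=
      CStarMatrix.ofMatrix fun k i => if k = a then Matrix.single a i 1 else 0
    have hR : C = star R * R := by
      ext1 i j
      rw [CStarMatrix.mul_apply, Finset.sum_eq_single a]
      · have h0 (l : n) : R a l = Matrix.single a l 1 := if_pos rfl
        rw [CStarMatrix.star_apply, h0, h0, Matrix.star_eq_conjTranspose,
          Matrix.conjTranspose_single, star_one, Matrix.single_mul_single_same, one_mul]
        rfl
      · intro k _ hk
        have h0 : R k j = 0 := if_neg hk
        rw [h0, mul_zero]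
      · simp
    rw [hR]
    exact star_mul_self_nonneg R
  obtain ⟨N, hN⟩ := exists_eq_star_mul_self_of_nonneg
    (CompletelyPositiveMap.map_cstarMatrix_nonneg E C hC)
  have hN' (i j : n) : E.toLinearMap (Matrix.single i j 1) = ∑ k, (N k i)ᴴ * N k j := by
    have := congrFun (congrFun hN i) j
    rw [CStarMatrix.mul_apply] at this
    exact this
  -- The Kraus operator for `(k, r)` collects the conjugated `r`-th rows of the blocks `N k i`, one
  -- column for each `i`.
  refine ⟨fun x => Matrix.of fun p i => star (N x.1 i x.2 p), fun X => ?_⟩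
  conv_lhs => rw [Matrix.matrix_eq_sum_single X]
  have hs (i j : n) : Matrix.single i j (X i j) = X i j • Matrix.single i j (1 : ℂ) := by
    rw [Matrix.smul_single, smul_eq_mul, mul_one]
  simp only [map_sum, hs, map_smul, hN']
  ext p q
  simp only [Matrix.sum_apply, Matrix.smul_apply, Matrix.mul_apply, Matrix.conjTranspose_apply,
    Matrix.of_apply, star_star, Fintype.sum_prod_type, smul_eq_mul, Finset.mul_sum,
    Finset.sum_mul]
  let g (k : n) (r : m) (j i : n) : ℂ := star (N k i r p) * X i j * N k j r q
  have hg : ∑ j, ∑ i, ∑ k, ∑ r, g k r j i = ∑ k, ∑ r, ∑ j, ∑ i, g k r j i := by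
    rw [(Finset.sum_congr rfl fun j _ => Finset.sum_comm : _ = ∑ j, ∑ k, ∑ i, ∑ r, g k r j i),
      Finset.sum_comm]
    refine Finset.sum_congr rfl fun k _ => ?_
    rw [(Finset.sum_congr rfl fun j _ => Finset.sum_comm : _ = ∑ j, ∑ r, ∑ i, g k r j i),
      Finset.sum_comm]
  rw [Finset.sum_comm]
  refine Eq.trans ?_ hg
  refine Finset.sum_congr rfl fun j _ => Finset.sum_congr rfl fun i _ =>
    Finset.sum_congr rfl fun k _ => Finset.sum_congr rfl fun r _ => ?_
  ring

/-! ### Fixed points and commutants -/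

/-- The fixed points of a unital map whose family of Kraus operators is closed under adjoints are
the matrices commuting with all Kraus operators. -/
theorem sum_mul_mul_conjTranspose_eq_self_iff {n ι : Type*} [Fintype n] [DecidableEq n]
    [Fintype ι] {M : ι → Matrix n n ℂ} (σ : Equiv.Perm ι) (hσ : ∀ i, M (σ i) = (M i)ᴴ)
    (h1 : ∑ i, M i * (M i)ᴴ = 1) (X : Matrix n n ℂ) :
    ∑ i, M i * X * (M i)ᴴ = X ↔ ∀ i, Commute X (M i) := by
  refine ⟨fun hX => ?_, fun hX => ?_⟩
  · have h2 : ∑ i, (M i)ᴴ * M i = 1 := by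
      rw [← h1, ← Equiv.sum_comp σ]
      simp [hσ]
    have hX' : ∑ i, (M i)ᴴ * X * M i = X := by
      conv_rhs => rw [← hX, ← Equiv.sum_comp σ]
      simp [hσ]
    -- The squared Hilbert–Schmidt norms of the commutators sum to four terms, each `± Tr(X†X)`,
    -- which cancel.
    have key : ∑ i, ((X * M i - M i * X)ᴴ * (X * M i - M i * X)).trace = 0 := by
      have e (i : ι) : ((X * M i - M i * X)ᴴ * (X * M i - M i * X)).trace =
          (Xᴴ * X * (M i * (M i)ᴴ)).trace - (Xᴴ * ((M i)ᴴ * X * M i)).trace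
          - (Xᴴ * (M i * X * (M i)ᴴ)).trace + (Xᴴ * ((M i)ᴴ * M i) * X).trace := by
        have e1 : ((M i)ᴴ * (Xᴴ * (X * M i))).trace = (Xᴴ * X * (M i * (M i)ᴴ)).trace := by
          rw [Matrix.trace_mul_comm]
          simp only [Matrix.mul_assoc]
        have e2 : ((M i)ᴴ * (Xᴴ * (M i * X))).trace = (Xᴴ * (M i * X * (M i)ᴴ)).trace := by
          rw [Matrix.trace_mul_comm]
          simp only [Matrix.mul_assoc]
        simp only [Matrix.conjTranspose_sub, Matrix.conjTranspose_mul, Matrix.sub_mul,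
          Matrix.mul_sub, Matrix.trace_sub, Matrix.mul_assoc] at e1 e2 ⊢
        rw [e1, e2]
        ring
      simp only [e, Finset.sum_add_distrib, Finset.sum_sub_distrib, ← Matrix.trace_sum,
        ← Matrix.mul_sum, ← Matrix.sum_mul, h1, h2, hX, hX']
      simp
    intro i
    have hi := (Finset.sum_eq_zero_iff_of_nonneg fun i _ =>
      (Matrix.posSemidef_conjTranspose_mul_self (X * M i - M i * X)).trace_nonneg).1 key i
      (Finset.mem_univ i)
    rw [Matrix.trace_conjTranspose_mul_self_eq_zero_iff] at hi
    exact sub_eq_zero.1 hi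
  · simp only [← fun i => (hX i).eq, Matrix.mul_assoc, ← Matrix.mul_sum, h1, Matrix.mul_one]

/-- If `O` commutes with `A * F ^ k * B` for all `k`, it commutes with
`A * f(F) * B` for every function `f`. -/
theorem commute_mul_cfc_mul {n m : Type*} [Fintype n] [DecidableEq n] [Fintype m]
    [DecidableEq m] {O : Matrix n n ℂ} {A : Matrix n m ℂ} {B : Matrix m n ℂ} {F : Matrix m m ℂ}
    (hF : IsSelfAdjoint F) (h : ∀ k : ℕ, Commute O (A * F ^ k * B)) (f : ℝ → ℝ) :
    Commute O (A * cfc f F * B) := by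
  have hfin : (spectrum ℝ F).Finite := Matrix.finite_real_spectrum
  -- The spectrum is finite, so `f` agrees on it with an interpolation polynomial.
  let p := Lagrange.interpolate hfin.toFinset id f
  have hp : cfc f F = Polynomial.aeval F p := by
    rw [← cfc_polynomial p F hF]
    refine cfc_congr fun x hx => ?_
    exact (Lagrange.eval_interpolate_at_node (v := id) f (Set.injOn_id _)
      (hfin.mem_toFinset.2 hx)).symm
  rw [hp, Polynomial.aeval_eq_sum_range, Matrix.mul_sum, Matrix.sum_mul]
  refine Commute.sum_right _ _ _ fun k _ => ?_
  rw [Matrix.mul_smul, Matrix.smul_mul]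
  exact (h k).smul_right _

/-- Peeling one factor off the power leaves a sum of products `(K a† K d) (K d† F ^ k K b)`, with `F
= c • ∑ K d K d†`. -/
theorem commute_mul_sum_pow_mul {n m κ : Type*} [Fintype n] [DecidableEq n] [Fintype m]
    [DecidableEq m] [Fintype κ] {K : κ → Matrix m n ℂ} {O : Matrix n n ℂ}
    (h : ∀ a b, Commute O ((K a)ᴴ * K b)) (c : ℂ) (k : ℕ) (a b : κ) :
    Commute O ((K a)ᴴ * (c • ∑ d, K d * (K d)ᴴ) ^ k * K b) := by
  induction k generalizing a with
  | zero => simpa using h a b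
  | succ k ih =>
    have e : (K a)ᴴ * (c • ∑ d, K d * (K d)ᴴ) ^ (k + 1) * K b =
        c • ∑ d, ((K a)ᴴ * K d) * ((K d)ᴴ * (c • ∑ d, K d * (K d)ᴴ) ^ k * K b) := by
      rw [pow_succ']
      simp only [Matrix.smul_mul, Matrix.mul_smul, Matrix.sum_mul, Matrix.mul_sum,
        Matrix.mul_assoc]
    rw [e]
    exact (Commute.sum_right _ _ _ fun d _ => (h a d).mul_right (ih d)).smul_right _

/-- If `A = c • ∑ K a K a†` with `c > 0`, then `A ^ (-1/2) A A ^ (-1/2)`, the projection onto the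
support of `A`, fixes the columns of each `K a`. -/
theorem psdPow_mul_mul_psdPow_mul {n m κ : Type*} [Fintype n] [Fintype m]
    [DecidableEq m] [Fintype κ] (K : κ → Matrix m n ℂ) {c : ℝ} (hc : 0 < c) {A : Matrix m m ℂ}
    (hA : A = (c : ℂ) • ∑ a, K a * (K a)ᴴ) (a : κ) :
    psdPow A (-(1 / 2)) * A * psdPow A (-(1 / 2)) * K a = K a := by
  have hpos : (∑ a, K a * (K a)ᴴ).PosSemidef :=
    Matrix.posSemidef_sum _ fun a _ => Matrix.posSemidef_self_mul_conjTranspose _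
  have hA0 : 0 ≤ A := by
    rw [hA, Matrix.nonneg_iff_posSemidef]
    exact hpos.smul (by exact_mod_cast hc.le)
  have hAs : IsSelfAdjoint A := .of_nonneg hA0
  have hcont (f : ℝ → ℝ) : ContinuousOn f (spectrum ℝ A) :=
    (Matrix.finite_real_spectrum (A := A)).continuousOn f
  set Q := psdPow A (-(1 / 2)) * A * psdPow A (-(1 / 2))
  have hQ' : Q = cfc (fun x : ℝ => x ^ (-(1 / 2) : ℝ) * x * x ^ (-(1 / 2) : ℝ)) A := by
    rw [cfc_mul _ _ A (hcont _) (hcont _), cfc_mul _ _ A (hcont _) (hcont _), cfc_id' ℝ A hAs]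
    rfl
  have hQA : Q * A = A := by
    rw [hQ']
    conv_lhs => enter [2]; rw [← cfc_id' ℝ A hAs]
    rw [← cfc_mul _ _ A (hcont _) (hcont _)]
    conv_rhs => rw [← cfc_id' ℝ A hAs]
    refine cfc_congr fun x hx => ?_
    -- At `x = 0` both sides vanish, so the value of the negative power there is harmless.
    rcases (spectrum_nonneg_of_nonneg hA0 hx).eq_or_lt with h0 | h0
    · simp [← h0]
    · have : x ^ (-(1 / 2) : ℝ) * x * x ^ (-(1 / 2) : ℝ) = 1 := by
        rw [mul_right_comm, ← Real.rpow_add h0]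
        norm_num
        rw [Real.rpow_neg_one, inv_mul_cancel₀ h0.ne']
      simp only [this, one_mul]
  have hc' : (c : ℂ) ≠ 0 := by exact_mod_cast hc.ne'
  -- `1 - Q` kills the whole sum `∑ K a K a†`; positivity of the summands then makes it kill each `K
  -- a`.
  have hsum : ∑ a, ((1 - Q) * K a) * ((1 - Q) * K a)ᴴ = 0 := by
    have h : (1 - Q) * (∑ a, K a * (K a)ᴴ) = 0 := by
      have : (c : ℂ) • ((1 - Q) * (∑ a, K a * (K a)ᴴ)) = 0 := by
        rw [← Matrix.mul_smul, ← hA, Matrix.sub_mul, Matrix.one_mul, hQA, sub_self]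
      exact (smul_eq_zero.1 this).resolve_left hc'
    calc _ = (1 - Q) * (∑ a, K a * (K a)ᴴ) * (1 - Q)ᴴ := by
          simp only [Matrix.conjTranspose_mul, Matrix.mul_sum, Matrix.sum_mul, Matrix.mul_assoc]
      _ = 0 := by rw [h, Matrix.zero_mul]
  have ha := (Finset.sum_eq_zero_iff_of_nonneg fun a _ => Matrix.nonneg_iff_posSemidef.2
    (Matrix.posSemidef_self_mul_conjTranspose ((1 - Q) * K a))).1 hsum a (Finset.mem_univ a)
  rw [Matrix.self_mul_conjTranspose_eq_zero, Matrix.sub_mul, Matrix.one_mul] at ha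
  exact (sub_eq_zero.1 ha).symm

theorem psdPow_maximallyMixed (n : Type*) [Fintype n] [DecidableEq n] (t : ℝ) :
    psdPow (maximallyMixed n) t = ((((Fintype.card n : ℝ)⁻¹ ^ t : ℝ)) : ℂ) • 1 := by
  have h : maximallyMixed n = algebraMap ℝ (Matrix n n ℂ) (Fintype.card n : ℝ)⁻¹ := by
    rw [Algebra.algebraMap_eq_smul_one, maximallyMixed]
    ext i j
    simp
  rw [psdPow, h, cfc_algebraMap, Algebra.algebraMap_eq_smul_one]
  ext i j
  simp

/-! ### The Petz map composed with the channel -/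

/-- The Kraus operators `d^{-1/2} K a† E(τ)^{-1/2} K b` of the composition of a map with its Petz
recovery map for the maximally mixed state. -/
noncomputable def petzKraus {n m κ : Type*} [Fintype n] [DecidableEq n] [Fintype m]
    [DecidableEq m] (E : Matrix n n ℂ →ₗ[ℂ] Matrix m m ℂ) (K : κ → Matrix m n ℂ) (x : κ × κ) :
    Matrix n n ℂ :=
  (((Fintype.card n : ℝ)⁻¹ ^ (1 / 2 : ℝ) : ℝ) : ℂ) •
    ((K x.1)ᴴ * psdPow (E (maximallyMixed n)) (-(1 / 2)) * K x.2)

theorem petzKraus_swap {n m κ : Type*} [Fintype n] [DecidableEq n] [Fintype m]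
    [DecidableEq m] (E : Matrix n n ℂ →ₗ[ℂ] Matrix m m ℂ) (K : κ → Matrix m n ℂ) (x : κ × κ) :
    petzKraus E K x.swap = (petzKraus E K x)ᴴ := by
  have h : (psdPow (E (maximallyMixed n)) (-(1 / 2)))ᴴ =
      psdPow (E (maximallyMixed n)) (-(1 / 2)) :=
    (cfc_predicate _ (E (maximallyMixed n)) : IsSelfAdjoint _)
  rw [petzKraus, petzKraus, Matrix.conjTranspose_smul, Matrix.conjTranspose_mul,
    Matrix.conjTranspose_mul, h, Matrix.conjTranspose_conjTranspose, Matrix.mul_assoc,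
    RCLike.star_def, Complex.conj_ofReal]
  rfl

namespace IsKrausFamily

variable {n m κ : Type*} [Fintype n] [DecidableEq n] [Fintype m] [DecidableEq m] [Fintype κ]
  {E : Matrix n n ℂ →ₗ[ℂ] Matrix m m ℂ} {K : κ → Matrix m n ℂ}

theorem petzMap_comp (hK : IsKrausFamily E K) :
    IsKrausFamily (petzMap (maximallyMixed n) E ∘ₗ E) (petzKraus E K) := fun X => by
  have h (x : κ × κ) : petzKraus E K x * X * (petzKraus E K x)ᴴ =
      petzKraus E K x * X * petzKraus E K x.swap := by rw [petzKraus_swap]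
  simp only [h]
  simp only [petzMap, LinearMap.comp_apply, sandwich, LinearMap.coe_mk, AddHom.coe_mk,
    hK.hsAdjoint_apply, psdPow_maximallyMixed, petzKraus, Fintype.sum_prod_type]
  rw [hK X]
  simp only [Matrix.smul_mul, Matrix.mul_smul, Matrix.sum_mul, Matrix.mul_sum, Matrix.one_mul,
    Matrix.mul_one, Finset.smul_sum, Matrix.mul_assoc, Prod.fst_swap, Prod.snd_swap]

theorem hsAdjoint_petzMap_comp (hK : IsKrausFamily E K) :
    hsAdjoint (petzMap (maximallyMixed n) E ∘ₗ E) = petzMap (maximallyMixed n) E ∘ₗ E := by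
  ext1 Y
  rw [hK.petzMap_comp.hsAdjoint_apply, hK.petzMap_comp Y, ← (Equiv.prodComm κ κ).sum_comp]
  simp [petzKraus_swap]

/-- Summing over the middle index rebuilds `E(τ)` between two factors `E(τ)^{-1/2}`, using up both
`d^{-1/2}`; the resulting support projection is absorbed by `K b`. -/
theorem petzKraus_mul_petzKraus (hK : IsKrausFamily E K) [Nonempty n] (a b : κ) :
    ∑ c, petzKraus E K (a, c) * petzKraus E K (c, b) = (K a)ᴴ * K b := by
  have hc : (0 : ℝ) < (Fintype.card n : ℝ)⁻¹ := by positivity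
  have hS := psdPow_mul_mul_psdPow_mul K hc hK.apply_maximallyMixed b
  have hs : (((Fintype.card n : ℝ)⁻¹ ^ (1 / 2 : ℝ) : ℝ) : ℂ) *
      (((Fintype.card n : ℝ)⁻¹ ^ (1 / 2 : ℝ) : ℝ) : ℂ) = (((Fintype.card n : ℝ)⁻¹ : ℝ) : ℂ) := by
    rw [← Complex.ofReal_mul, ← Real.rpow_add hc]
    norm_num
  set S := psdPow (E (maximallyMixed n)) (-(1 / 2)) with hSdef
  conv_rhs => rw [← hS, hK.apply_maximallyMixed]
  simp only [petzKraus, ← hSdef, Matrix.smul_mul, Matrix.mul_smul, smul_smul, hs, Matrix.sum_mul,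
    Matrix.mul_sum, Finset.smul_sum, Matrix.mul_assoc]

theorem sum_petzKraus (hK : IsKrausFamily E K) (hE : ∀ X, (E X).trace = X.trace) :
    ∑ x, petzKraus E K x * (petzKraus E K x)ᴴ = 1 := by
  rcases isEmpty_or_nonempty n with hn | hn
  · exact Subsingleton.elim _ _
  simp only [← petzKraus_swap, Fintype.sum_prod_type, Prod.swap_prod_mk,
    hK.petzKraus_mul_petzKraus, hK.sum_conjTranspose_mul_self hE]

theorem mem_fixedPoints_petzMap_comp_iff (hK : IsKrausFamily E K)
    (hE : ∀ X, (E X).trace = X.trace) (X : Matrix n n ℂ) :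
    X ∈ Function.fixedPoints (petzMap (maximallyMixed n) E ∘ₗ E) ↔
      ∀ a b, Commute X ((K a)ᴴ * K b) := by
  rw [Function.mem_fixedPoints, Function.IsFixedPt, hK.petzMap_comp X,
    sum_mul_mul_conjTranspose_eq_self_iff (Equiv.prodComm κ κ) (petzKraus_swap E K)
      (hK.sum_petzKraus hE)]
  refine ⟨fun h a b => ?_, fun h x => ?_⟩
  · rcases isEmpty_or_nonempty n with hn | hn
    · exact Subsingleton.elim _ _
    rw [← hK.petzKraus_mul_petzKraus]
    exact Commute.sum_right _ _ _ fun c _ => (h _).mul_right (h _)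
  · refine (commute_mul_cfc_mul ?_ (fun k => ?_) _).smul_right _
    · rw [hK.apply_maximallyMixed]
      simp [IsSelfAdjoint, Matrix.star_eq_conjTranspose]
    · rw [hK.apply_maximallyMixed]
      exact commute_mul_sum_pow_mul h _ _ _ _

end IsKrausFamily

/-! ### Correctable algebras and the main theorem -/

/-- The algebra generated by the commutant of a set is that commutant. -/
theorem coe_adjoin_forall_commute {A : Type*} [Ring A] [Algebra ℂ A] (s : Set A) :
    (Algebra.adjoin ℂ {x | ∀ y ∈ s, Commute x y} : Set A) = {x | ∀ y ∈ s, Commute x y} := by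
  have h : {x | ∀ y ∈ s, Commute x y} = (Subalgebra.centralizer ℂ s : Set A) := by
    ext x
    simp only [Set.mem_ofPred_eq, SetLike.mem_coe, Subalgebra.mem_centralizer_iff]
    exact forall₂_congr fun y _ => eq_comm
  rw [h, Algebra.adjoin_eq]

theorem coe_krausCorrectableAlgebra {n m κ : Type*} [Fintype n] [DecidableEq n] [Fintype m]
    (K : κ → Matrix m n ℂ) : (krausCorrectableAlgebra K : Set (Matrix n n ℂ)) =
      {O | ∀ a b, Commute O ((K a)ᴴ * K b)} := by
  have h : {O | ∀ a b, Commute O ((K a)ᴴ * K b)} =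
      {O | ∀ y ∈ {y | ∃ a b, y = (K a)ᴴ * K b}, Commute O y} := by
    ext O
    exact ⟨fun h y ⟨a, b, e⟩ => e ▸ h a b, fun h a b => h _ ⟨a, b, rfl⟩⟩
  rw [krausCorrectableAlgebra, h, coe_adjoin_forall_commute]

theorem coe_correctableAlgebra {n m : Type*} [Fintype n] [DecidableEq n] [Fintype m]
    (E : Matrix n n ℂ →ₗ[ℂ] Matrix m m ℂ) : (correctableAlgebra E : Set (Matrix n n ℂ)) =
      {O | ∀ (r : ℕ) (K : Fin r → Matrix m n ℂ), IsKrausFamily E K →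
        ∀ a b, Commute O ((K a)ᴴ * K b)} := by
  have h : {O | ∀ (r : ℕ) (K : Fin r → Matrix m n ℂ), IsKrausFamily E K →
        ∀ a b, Commute O ((K a)ᴴ * K b)} =
      {O | ∀ y ∈ {y | ∃ (r : ℕ) (K : Fin r → Matrix m n ℂ), IsKrausFamily E K ∧
        ∃ a b, y = (K a)ᴴ * K b}, Commute O y} := by
    ext O
    exact ⟨fun h y ⟨r, K, hK, a, b, e⟩ => e ▸ h r K hK a b,
      fun h r K hK a b => h _ ⟨r, K, hK, a, b, rfl⟩⟩
  rw [correctableAlgebra, h, coe_adjoin_forall_commute]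

theorem mainTheorem10 {n m : Type*} [Fintype n] [DecidableEq n] [Fintype m] [DecidableEq m]
    (E : Matrix n n ℂ →CP Matrix m m ℂ)
    (hE : ∀ X : Matrix n n ℂ, (E X).trace = X.trace) :
    let P : Matrix m m ℂ →ₗ[ℂ] Matrix n n ℂ := petzMap (maximallyMixed n) E.toLinearMap
    let Z : Matrix n n ℂ →ₗ[ℂ] Matrix n n ℂ := P ∘ₗ E.toLinearMap
    let Z' : Matrix n n ℂ →ₗ[ℂ] Matrix n n ℂ := hsAdjoint E.toLinearMap ∘ₗ hsAdjoint P
    (correctableAlgebra E.toLinearMap : Set (Matrix n n ℂ)) = Function.fixedPoints Z ∧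
    (correctableAlgebra E.toLinearMap : Set (Matrix n n ℂ)) = Function.fixedPoints Z' ∧
    hsAdjoint Z = Z ∧ Z' = hsAdjoint Z ∧
    (∃ (r : ℕ) (K : Fin r → Matrix m n ℂ), IsKrausFamily E.toLinearMap K) ∧
    (∀ (κ : Type) [Fintype κ] (K : κ → Matrix m n ℂ), IsKrausFamily E.toLinearMap K →
      krausCorrectableAlgebra K = correctableAlgebra E.toLinearMap) := by
  intro P Z Z'
  obtain ⟨r, K, hK⟩ := exists_isKrausFamily E
  have hfix : (correctableAlgebra E.toLinearMap : Set (Matrix n n ℂ)) = Function.fixedPoints Z := by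
    rw [coe_correctableAlgebra]
    ext X
    -- The existence of `K` keeps the condition over all families from being vacuous; conversely, a
    -- fixed point satisfies it for every family.
    exact ⟨fun h => (hK.mem_fixedPoints_petzMap_comp_iff hE X).2 (h r K hK),
      fun h s L hL => (hL.mem_fixedPoints_petzMap_comp_iff hE X).1 h⟩
  have hZ : hsAdjoint Z = Z := hK.hsAdjoint_petzMap_comp
  have hZ' : Z' = hsAdjoint Z := (hsAdjoint_comp P E.toLinearMap).symm
  refine ⟨hfix, by rw [hZ', hZ]; exact hfix, hZ, hZ', ⟨r, K, hK⟩, fun κ _ L hL => ?_⟩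
  refine SetLike.coe_injective ?_
  rw [hfix, coe_krausCorrectableAlgebra]
  ext X
  exact (hL.mem_fixedPoints_petzMap_comp_iff hE X).symm
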